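/- Write a permutation $\sigma\in S_n$ of $\{1,\dots,n\}$ as a word $\sigma_1\cdots\sigma_n$, and put $\mathrm{des}(\sigma)=|\{i<n:\sigma_i>\sigma_{i+1}\}|$ and $\mathrm{inv}(\sigma)=|\{(i,k): i<k,\ \sigma_i>\sigma_k\}|$. For $\tau\in S_j$, a $\tau$-match in $\sigma$ is a position $i$ with $i+j-1\le n$ such that the word $\sigma_i\sigma_{i+1}\cdots\sigma_{i+j-1}$ has the same relative order as $\tau$; let $\mathcal{NM}_n(\tau)$ be the set of $\sigma\in S_n$ with no $\tau$-match. For $j\ge 3$, $\tau\in S_j$ is called minimal overlapping if the smallest $i$ for which some $\sigma\in S_i$ has exactly two $\tau$-matches is $i=2j-1$. For permutation statistics $\mathrm{stat}_1,\dots,\mathrm{stat}_k$, permutations $\alpha,\beta\in S_j$ are called $(\mathrm{stat}_1,\dots,\mathrm{stat}_k)$-c-Wilf equivalent if for all $n\ge 1$ $$\sum_{\sigma\in\mathcal{NM}_n(\alpha)}\prod_{i=1}^k x_i^{\mathrm{stat}_i(\sigma)}=\sum_{\sigma\in\mathcal{NM}_n(\beta)}\prod_{i=1}^k x_i^{\mathrm{stat}_i(\sigma)}$$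 as polynomials in $x_1,\dots,x_k$. Let $[n]_q=1+q+\cdots+q^{n-1}$ and $[n]_q!=[1]_q[2]_q\cdots[n]_q$, with $[0]_q!=1$. **Theorem.** Let $j\ge 3$ and let $\alpha=\alpha_1\cdots\alpha_j$ and $\beta=\beta_1\cdots\beta_j$ be minimal overlapping permutations in $S_j$ such that $\alpha_1=\beta_1=1$, $\alpha_j=\beta_j$ and $\mathrm{des}(\alpha)=\mathrm{des}(\beta)$. Then $$\sum_{n\ge 0}\frac{t^n}{n!}\sum_{\sigma\in\mathcal{NM}_n(\alpha)}x^{\mathrm{des}(\sigma)}=\sum_{n\ge 0}\frac{t^n}{n!}\sum_{\sigma\in\mathcal{NM}_n(\beta)}x^{\mathrm{des}(\sigma)}$$ as formal power series in $t$, and $\alpha$ and $\beta$ are $\mathrm{des}$-c-Wilf equivalent. If in addition $\mathrm{inv}(\alpha)=\mathrm{inv}(\beta)$, then $$\sum_{n\ge 0}\frac{t^n}{[n]_q!}\sum_{\sigma\in\mathcal{NM}_n(\alpha)}x^{\mathrm{des}(\sigma)}q^{\mathrm{inv}(\sigma)}=\sum_{n\ge 0}\frac{t^n}{[n]_q!}\sum_{\sigma\in\mathcal{NM}_n(\beta)}x^{\mathrm{des}(\sigma)}q^{\mathrm{inv}(\sigma)},$$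 and $\alpha$ and $\beta$ are $(\mathrm{des},\mathrm{inv})$-c-Wilf equivalent. -/

import Mathlib

open scoped Nat

namespace CWilf

/-- `Des(σ)`: the positions `i` with `σ_i > σ_{i+1}`. Permutations of `{1,…,n}` are represented by
`Equiv.Perm (Fin n)`, so positions and values are shifted down by one. -/
def desSet {n : ℕ} (σ : Equiv.Perm (Fin n)) : Finset (Fin n) :=
  Finset.univ.filter fun i => ∃ h : (i : ℕ) + 1 < n, σ ⟨(i : ℕ) + 1, h⟩ < σ i

/-- The number of descents. -/
def des {n : ℕ} (σ : Equiv.Perm (Fin n)) : ℕ := (desSet σ).card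

/-- The number of inversions. -/
def inv {n : ℕ} (σ : Equiv.Perm (Fin n)) : ℕ :=
  (Finset.univ.filter fun p : Fin n × Fin n => p.1 < p.2 ∧ σ p.2 < σ p.1).card

/-- The reduction of a word with distinct letters: each letter is replaced by its rank among the
letters of the word (the smallest letter has rank `0`). -/
def red {m n : ℕ} (w : Fin m → Fin n) (k : Fin m) : ℕ :=
  (Finset.univ.filter fun l => w l < w k).card

/-- There is a `τ`-match in `σ` starting in position `i`: the word
`σ_i σ_{i+1} … σ_{i+j-1}` exists and its reduction is `τ`. -/
def IsMatchAt {j n : ℕ} (τ : Equiv.Perm (Fin j)) (σ : Equiv.Perm (Fin n)) (i : ℕ) : Prop :=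
  ∃ h : i + j ≤ n, ∀ k : Fin j,
    red (fun l : Fin j => σ ⟨i + (l : ℕ), by omega⟩) k = (τ k : ℕ)

instance {j n : ℕ} (τ : Equiv.Perm (Fin j)) (σ : Equiv.Perm (Fin n)) (i : ℕ) :
    Decidable (IsMatchAt τ σ i) := by
  unfold IsMatchAt; infer_instance

/-- The number of `τ`-matches of `σ`. -/
def mch {j n : ℕ} (τ : Equiv.Perm (Fin j)) (σ : Equiv.Perm (Fin n)) : ℕ :=
  ((Finset.range n).filter fun i => IsMatchAt τ σ i).card

/-- The set of permutations of length `n` without `τ`-matches. -/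
def NM {j : ℕ} (n : ℕ) (τ : Equiv.Perm (Fin j)) : Finset (Equiv.Perm (Fin n)) :=
  Finset.univ.filter fun σ => mch τ σ = 0

/-- The minimal overlapping property of `τ ∈ S_j`, `j ≥ 3`: the smallest length of a permutation
with exactly two `τ`-matches is `2j - 1`. -/
def MinimalOverlapping {j : ℕ} (τ : Equiv.Perm (Fin j)) : Prop :=
  3 ≤ j ∧ IsLeast {i : ℕ | ∃ σ : Equiv.Perm (Fin i), mch τ σ = 2} (2 * j - 1)

/-- A permutation statistic, defined on permutations of every length. -/
abbrev PermStat : Type := ∀ n : ℕ, Equiv.Perm (Fin n) → ℕ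

/-- `α` and `β` are `(stat_1,…,stat_k)`-c-Wilf equivalent. -/
def StatCWilfEquiv {j k : ℕ} (stat : Fin k → PermStat) (α β : Equiv.Perm (Fin j)) : Prop :=
  ∀ n : ℕ, 1 ≤ n →
    (∑ σ ∈ NM n α, ∏ i : Fin k, (MvPolynomial.X i : MvPolynomial (Fin k) ℤ) ^ stat i n σ) =
      ∑ σ ∈ NM n β, ∏ i : Fin k, (MvPolynomial.X i : MvPolynomial (Fin k) ℤ) ^ stat i n σ

/-- `des` as a permutation statistic. -/
def desStat : PermStat := fun _ σ => des σ

/-- `inv` as a permutation statistic. -/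
def invStat : PermStat := fun _ σ => inv σ

/-- `[n]_q = 1 + q + ⋯ + q^{n-1}`. -/
def qNat {R : Type*} [CommRing R] (q : R) (n : ℕ) : R := ∑ i ∈ Finset.range n, q ^ i

/-- `[n]_q! = [1]_q [2]_q ⋯ [n]_q`. -/
def qFactorial {R : Type*} [CommRing R] (q : R) (n : ℕ) : R :=
  ∏ i ∈ Finset.range n, qNat q (i + 1)

/-- `∑_{n ≥ 0} t^n / n! ∑_{σ ∈ NM_n(τ)} x^{des σ}`, a power series in `t` over `ℚ[x]`. -/
noncomputable def desEGF {j : ℕ} (τ : Equiv.Perm (Fin j)) : PowerSeries (Polynomial ℚ) :=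
  PowerSeries.mk fun n =>
    Polynomial.C ((n ! : ℚ)⁻¹) * ∑ σ ∈ NM n τ, (Polynomial.X : Polynomial ℚ) ^ des σ

/-- `∑_{n ≥ 0} t^n / [n]_q! ∑_{σ ∈ NM_n(τ)} x^{des σ} q^{inv σ}`, a power series in `t` over
`ℚ(q)[x]`; the indeterminate `q` is `RatFunc.X`. -/
noncomputable def desInvQEGF {j : ℕ} (τ : Equiv.Perm (Fin j)) :
    PowerSeries (Polynomial (RatFunc ℚ)) :=
  PowerSeries.mk fun n =>
    Polynomial.C ((qFactorial (RatFunc.X : RatFunc ℚ) n)⁻¹) *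
      ∑ σ ∈ NM n τ, (Polynomial.X : Polynomial (RatFunc ℚ)) ^ des σ *
        Polynomial.C ((RatFunc.X : RatFunc ℚ) ^ inv σ)

end CWilf

namespace CWilf

/-! ### Ranks of letters and standardization of words. -/

section Reduction

variable {m n : ℕ}

/-! By inclusion-exclusion, the weighted count of match-free permutations is a signed sum over sets
`S` of positions, of the total weight of the `σ` having a match at every point of `S`
(`sum_NM_eq_sum_powerset`). Matches of a minimal overlapping pattern share at most one letter
(`MinimalOverlapping.add_le_of_lt`), so only sets `S` with gaps at least `j - 1` contribute.

For such `S`, permuting the positions of a block by `α⁻¹ * β` turns an `α`-match into a `β`-match.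
Since `α` and `β` agree at both ends, only the interior of the block moves, so the other marked
matches survive, and the marks can be exchanged one at a time (`sum_marked_eq`). Each exchange is a
bijection that keeps `des`, and also `inv` when the patterns have equally many inversions
(`des_mul_blockPerm`, `inv_mul_blockPerm`). The terms for `α` and `β` thus agree for every `S`, and
the generating functions agree coefficientwise. -/

lemma red_lt_red {w : Fin m → Fin n} {k l : Fin m} (h : w k < w l) : red w k < red w l := by
  unfold red
  apply Finset.card_lt_card
  rw [Finset.ssubset_iff_of_subset]
  · exact ⟨k, by simpa using h, by simp⟩
  · intro a ha
    simp only [Finset.mem_filter, Finset.mem_univ, true_and] at ha ⊢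
    exact ha.trans h

lemma red_lt_red_iff {w : Fin m → Fin n} (hw : Function.Injective w) {k l : Fin m} :
    red w k < red w l ↔ w k < w l := by
  refine ⟨fun h => ?_, red_lt_red⟩
  rcases lt_trichotomy (w k) (w l) with h' | h' | h'
  · exact h'
  · rw [hw h'] at h
    exact absurd h (lt_irrefl _)
  · exact absurd h (red_lt_red h').asymm

lemma red_comp_perm (w : Fin m → Fin n) (ρ : Equiv.Perm (Fin m)) (k : Fin m) :
    red (fun l => w (ρ l)) k = red w (ρ k) := by
  unfold red
  refine Finset.card_bij (fun a _ => ρ a) ?_ ?_ ?_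
  · intro a ha
    simpa using ha
  · intro a _ b _ hab
    exact ρ.injective hab
  · intro b hb
    exact ⟨ρ.symm b, by simpa using hb, by simp⟩

/-- Every injective word is order isomorphic to a permutation, its standardization. -/
lemma exists_perm_lt_iff {w : Fin m → Fin n} (hw : Function.Injective w) :
    ∃ ρ : Equiv.Perm (Fin m), ∀ k l, ρ k < ρ l ↔ w k < w l := by
  have hlt : ∀ k, red w k < m := fun k => by
    have : red w k < (Finset.univ : Finset (Fin m)).card := by
      unfold red
      apply Finset.card_lt_card
      rw [Finset.ssubset_iff_of_subset (Finset.subset_univ _)]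
      exact ⟨k, by simp, by simp⟩
    simpa using this
  have hinj : Function.Injective (fun k => (⟨red w k, hlt k⟩ : Fin m)) := by
    intro k l h
    have h' : red w k = red w l := by simpa using h
    apply hw
    rcases lt_trichotomy (w k) (w l) with c | c | c
    · have := red_lt_red c
      omega
    · exact c
    · have := red_lt_red c
      omega
  refine ⟨Equiv.ofBijective _ (Finite.injective_iff_bijective.mp hinj), fun k l => ?_⟩
  simp only [Equiv.ofBijective_apply, Fin.mk_lt_mk]
  exact red_lt_red_iff hw

end Reduction

/-! ### Spacing of the matches of a minimal overlapping pattern. -/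

section Matches

variable {j n : ℕ}

lemma IsMatchAt.lt_iff {τ : Equiv.Perm (Fin j)} {σ : Equiv.Perm (Fin n)} {i : ℕ}
    (hm : IsMatchAt τ σ i) (h : i + j ≤ n) (k l : Fin j) :
    σ ⟨i + k, by omega⟩ < σ ⟨i + l, by omega⟩ ↔ τ k < τ l := by
  obtain ⟨_, hr⟩ := hm
  rw [Fin.lt_def (a := τ k), ← hr k, ← hr l, red_lt_red_iff]
  intro a b hab
  have := σ.injective hab
  simp only [Fin.mk.injEq] at this
  ext
  omega

/-- Matches of a minimal overlapping permutation share at most one letter. -/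
lemma MinimalOverlapping.add_le_of_lt {τ : Equiv.Perm (Fin j)} (hτ : MinimalOverlapping τ)
    {σ : Equiv.Perm (Fin n)} {i i' : ℕ} (hi : IsMatchAt τ σ i) (hi' : IsMatchAt τ σ i')
    (hlt : i < i') : i + j ≤ i' + 1 := by
  classical
  obtain ⟨hj, -, hmin⟩ := hτ
  -- The match at `i'` need not be the next one after `i`. With the least shift `d`, the window of
  -- length `d + j` contains exactly two matches, and its standardization `ρ` is a competitor in the
  -- minimality of `2 * j - 1`.
  have hex : ∃ d, 0 < d ∧ IsMatchAt τ σ (i + d) :=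
    ⟨i' - i, by omega, by rwa [Nat.add_sub_cancel' hlt.le]⟩
  obtain ⟨hd0, hd⟩ := Nat.find_spec hex
  have hdle : Nat.find hex ≤ i' - i :=
    Nat.find_min' hex ⟨by omega, by rwa [Nat.add_sub_cancel' hlt.le]⟩
  have hnext : ∀ e, 0 < e → e < Nat.find hex → ¬ IsMatchAt τ σ (i + e) :=
    fun e he hlt hm => Nat.find_min hex hlt ⟨he, hm⟩
  generalize Nat.find hex = d at hd0 hd hdle hnext
  have hdn : i + d + j ≤ n := hd.1
  let w : Fin (d + j) → Fin n := fun l => σ ⟨i + l, by omega⟩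
  have hw : Function.Injective w := by
    intro a b hab
    have := σ.injective hab
    simp only [Fin.mk.injEq] at this
    ext
    omega
  obtain ⟨ρ, hρ⟩ := exists_perm_lt_iff hw
  have hmatch : ∀ k, k + j ≤ d + j → (IsMatchAt τ ρ k ↔ IsMatchAt τ σ (i + k)) := by
    intro k hk
    have hred : ∀ a : Fin j, red (fun l : Fin j => ρ ⟨k + (l : ℕ), by omega⟩) a =
        red (fun l : Fin j => σ ⟨i + k + (l : ℕ), by omega⟩) a := by
      intro a
      unfold red
      congr 1
      ext l
      simp only [Finset.mem_filter, Finset.mem_univ, true_and]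
      rw [hρ]
      simp only [w, Nat.add_assoc]
    constructor
    · rintro ⟨_, h⟩
      exact ⟨by omega, fun a => by rw [← hred a, h a]⟩
    · rintro ⟨_, h⟩
      exact ⟨by omega, fun a => by rw [hred a, h a]⟩
  have hset : (Finset.range (d + j)).filter (fun k => IsMatchAt τ ρ k) = {0, d} := by
    ext k
    simp only [Finset.mem_filter, Finset.mem_range, Finset.mem_insert, Finset.mem_singleton]
    constructor
    · rintro ⟨-, hk⟩
      have hkd := hk.1
      by_contra hne
      exact hnext k (by omega) (by omega) ((hmatch k hkd).mp hk)
    · rintro (rfl | rfl)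
      · exact ⟨by omega, (hmatch 0 (by omega)).mpr hi⟩
      · exact ⟨by omega, (hmatch k le_rfl).mpr hd⟩
  have htwo : mch τ ρ = 2 := by
    unfold mch
    rw [hset, Finset.card_pair hd0.ne]
  -- Minimality reads `2 * j - 1 ≤ d + j`, so `j - 1 ≤ d ≤ i' - i`.
  have := hmin ⟨ρ, htwo⟩
  omega

end Matches

/-! ### Rearranging a block of positions, and its effect on descents and inversions. -/

section Block

variable {j n : ℕ}

/-- The embedding of the block of positions `i, …, i + j - 1`. -/
def blockEmb (i : ℕ) (h : i + j ≤ n) : Fin j ↪ Fin n where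
  toFun k := ⟨i + k, by omega⟩
  inj' a b hab := by
    simp only [Fin.mk.injEq] at hab
    ext
    omega

lemma blockEmb_apply {i : ℕ} (h : i + j ≤ n) (k : Fin j) :
    blockEmb i h k = ⟨i + k, by omega⟩ := rfl

lemma mem_range_blockEmb {i : ℕ} (h : i + j ≤ n) (p : Fin n) :
    p ∈ Set.range (blockEmb i h) ↔ i ≤ p ∧ (p : ℕ) < i + j := by
  constructor
  · rintro ⟨k, rfl⟩
    simp [blockEmb_apply]
  · rintro ⟨h1, h2⟩
    exact ⟨⟨p - i, by omega⟩, by ext; simp [blockEmb_apply]; omega⟩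

/-- The permutation of positions that acts as `ρ` on the block `i, …, i + j - 1`. -/
noncomputable def blockPerm (ρ : Equiv.Perm (Fin j)) (i : ℕ) (h : i + j ≤ n) :
    Equiv.Perm (Fin n) :=
  open Classical in ρ.viaFintypeEmbedding (blockEmb i h)

lemma blockPerm_apply_block (ρ : Equiv.Perm (Fin j)) {i : ℕ} (h : i + j ≤ n) (k : Fin j) :
    blockPerm ρ i h ⟨i + k, by omega⟩ = ⟨i + ρ k, by omega⟩ := by
  classical
  exact Equiv.Perm.viaFintypeEmbedding_apply_image ρ (blockEmb i h) k

lemma blockPerm_apply_of_notMem (ρ : Equiv.Perm (Fin j)) {i : ℕ} (h : i + j ≤ n) {p : Fin n}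
    (hp : ¬ (i ≤ p ∧ (p : ℕ) < i + j)) : blockPerm ρ i h p = p := by
  classical
  exact Equiv.Perm.viaFintypeEmbedding_apply_notMem_range ρ (blockEmb i h)
    (mt (mem_range_blockEmb h p).mp hp)

lemma blockPerm_mem_block (ρ : Equiv.Perm (Fin j)) {i : ℕ} (h : i + j ≤ n) (p : Fin n) :
    (i ≤ (blockPerm ρ i h p : ℕ) ∧ (blockPerm ρ i h p : ℕ) < i + j) ↔
      (i ≤ p ∧ (p : ℕ) < i + j) := by
  by_cases hp : i ≤ p ∧ (p : ℕ) < i + j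
  · obtain ⟨k, rfl⟩ := (mem_range_blockEmb h p).mpr hp
    have := blockPerm_apply_block ρ h k
    rw [blockEmb_apply, this]
    simp
  · rw [blockPerm_apply_of_notMem ρ h hp]

/-- A block permutation that fixes the ends of the block fixes everything outside the interior. -/
lemma blockPerm_apply_of_notMem_interior {ρ : Equiv.Perm (Fin j)} (hj : 0 < j)
    (h0 : ρ ⟨0, hj⟩ = ⟨0, hj⟩) (h1 : ρ ⟨j - 1, by omega⟩ = ⟨j - 1, by omega⟩)
    {i : ℕ} (h : i + j ≤ n) {p : Fin n} (hp : ¬ (i < p ∧ (p : ℕ) + 1 < i + j)) :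
    blockPerm ρ i h p = p := by
  by_cases hb : i ≤ p ∧ (p : ℕ) < i + j
  · have hcase : (p : ℕ) = i ∨ (p : ℕ) = i + (j - 1) := by omega
    rcases hcase with hc | hc
    · have := blockPerm_apply_block ρ h ⟨0, hj⟩
      simp only [h0] at this
      have hp' : p = ⟨i + 0, by omega⟩ := Fin.ext hc
      rwa [← hp'] at this
    · have := blockPerm_apply_block ρ h ⟨j - 1, by omega⟩
      simp only [h1] at this
      have hp' : p = ⟨i + (j - 1), by omega⟩ := Fin.ext hc
      rwa [← hp'] at this
  · exact blockPerm_apply_of_notMem ρ h hb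

lemma blockPerm_mul_blockPerm_inv (ρ : Equiv.Perm (Fin j)) {i : ℕ} (h : i + j ≤ n) :
    blockPerm ρ i h * blockPerm ρ⁻¹ i h = 1 := by
  ext p : 1
  rw [Equiv.Perm.mul_apply, Equiv.Perm.one_apply]
  by_cases hp : i ≤ p ∧ (p : ℕ) < i + j
  · obtain ⟨k, rfl⟩ := (mem_range_blockEmb h p).mpr hp
    rw [blockEmb_apply, blockPerm_apply_block, blockPerm_apply_block]
    simp
  · rw [blockPerm_apply_of_notMem ρ⁻¹ h hp, blockPerm_apply_of_notMem ρ h hp]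

/-- Rearranging a block changes the pattern matched by this block accordingly. -/
lemma IsMatchAt.mul_blockPerm {τ : Equiv.Perm (Fin j)} {σ : Equiv.Perm (Fin n)} {i : ℕ}
    (hm : IsMatchAt τ σ i) (ρ : Equiv.Perm (Fin j)) :
    IsMatchAt (τ * ρ) (σ * blockPerm ρ i hm.1) i := by
  obtain ⟨h, hr⟩ := hm
  refine ⟨h, fun k => ?_⟩
  have := red_comp_perm (fun l : Fin j => σ ⟨i + (l : ℕ), by omega⟩) ρ k
  rw [hr] at this
  simp only [Equiv.Perm.mul_apply, blockPerm_apply_block]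
  exact this

/-- Rearranging the interior of a block does not affect matches which share only end points
with it. -/
lemma IsMatchAt.mul_blockPerm_of_disjoint {τ : Equiv.Perm (Fin j)} {σ : Equiv.Perm (Fin n)}
    {i i' : ℕ} (hm : IsMatchAt τ σ i') {ρ : Equiv.Perm (Fin j)} (hj : 0 < j)
    (h0 : ρ ⟨0, hj⟩ = ⟨0, hj⟩) (h1 : ρ ⟨j - 1, by omega⟩ = ⟨j - 1, by omega⟩)
    (h : i + j ≤ n) (hdis : i + j ≤ i' + 1 ∨ i' + j ≤ i + 1) :
    IsMatchAt τ (σ * blockPerm ρ i h) i' := by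
  obtain ⟨h', hr⟩ := hm
  refine ⟨h', fun k => ?_⟩
  rw [← hr k]
  congr 1
  ext l : 1
  rw [Equiv.Perm.mul_apply, blockPerm_apply_of_notMem_interior hj h0 h1]
  simp only
  omega

lemma mem_desSet {σ : Equiv.Perm (Fin n)} {p : Fin n} :
    p ∈ desSet σ ↔ ∃ h : (p : ℕ) + 1 < n, σ ⟨(p : ℕ) + 1, h⟩ < σ p := by
  simp [desSet]

/-- The number of descents inside a match of `τ` is `des τ`. -/
lemma IsMatchAt.card_desSet_block {τ : Equiv.Perm (Fin j)} {σ : Equiv.Perm (Fin n)} {i : ℕ}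
    (hm : IsMatchAt τ σ i) :
    ((desSet σ).filter fun p : Fin n => i ≤ (p : ℕ) ∧ (p : ℕ) + 1 < i + j).card = des τ := by
  have h := hm.1
  symm
  refine Finset.card_bij (fun k _ => blockEmb i h k) ?_ ?_ ?_
  · intro k hk
    obtain ⟨hk1, hk2⟩ := mem_desSet.mp hk
    rw [Finset.mem_filter, mem_desSet]
    have := (hm.lt_iff h ⟨k + 1, hk1⟩ k).mpr hk2
    exact ⟨⟨by simp [blockEmb_apply]; omega, this⟩, by simp [blockEmb_apply], by simp [blockEmb_apply]; omega⟩
  · intro a _ b _ hab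
    exact (blockEmb i h).injective hab
  · intro p hp
    rw [Finset.mem_filter, mem_desSet] at hp
    obtain ⟨⟨hp1, hp2⟩, hp3, hp4⟩ := hp
    obtain ⟨k, rfl⟩ := (mem_range_blockEmb h p).mpr ⟨hp3, by omega⟩
    refine ⟨k, ?_, rfl⟩
    have hk : (k : ℕ) + 1 < j := by
      simp only [blockEmb_apply] at hp4
      omega
    exact mem_desSet.mpr ⟨hk, (hm.lt_iff h ⟨k + 1, hk⟩ k).mp hp2⟩

/-- The number of inversions inside a match of `τ` is `inv τ`. -/
lemma IsMatchAt.card_inv_block {τ : Equiv.Perm (Fin j)} {σ : Equiv.Perm (Fin n)} {i : ℕ}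
    (hm : IsMatchAt τ σ i) :
    ((Finset.univ.filter fun p : Fin n × Fin n => p.1 < p.2 ∧ σ p.2 < σ p.1).filter fun p =>
      (i ≤ (p.1 : ℕ) ∧ (p.1 : ℕ) < i + j) ∧ (i ≤ (p.2 : ℕ) ∧ (p.2 : ℕ) < i + j)).card =
      inv τ := by
  have h := hm.1
  symm
  have hlt : ∀ k l : Fin j, blockEmb i h k < blockEmb i h l ↔ k < l := by
    intro k l
    simp [blockEmb_apply]
  refine Finset.card_bij (fun k _ => (blockEmb i h k.1, blockEmb i h k.2)) ?_ ?_ ?_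
  · rintro ⟨k, l⟩ hk
    simp only [Finset.mem_filter, Finset.mem_univ, true_and] at hk ⊢
    exact ⟨⟨(hlt k l).mpr hk.1, (hm.lt_iff h l k).mpr hk.2⟩,
      (mem_range_blockEmb h _).mp ⟨k, rfl⟩, (mem_range_blockEmb h _).mp ⟨l, rfl⟩⟩
  · rintro ⟨a, b⟩ _ ⟨c, d⟩ _ hab
    simpa using hab
  · rintro ⟨p, r⟩ hp
    simp only [Finset.mem_filter, Finset.mem_univ, true_and] at hp
    obtain ⟨⟨hp1, hp2⟩, hp3, hp4⟩ := hp
    obtain ⟨k, rfl⟩ := (mem_range_blockEmb h p).mpr hp3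
    obtain ⟨l, rfl⟩ := (mem_range_blockEmb h r).mpr hp4
    refine ⟨(k, l), ?_, rfl⟩
    simp only [Finset.mem_filter, Finset.mem_univ, true_and]
    exact ⟨(hlt k l).mp hp1, (hm.lt_iff h l k).mp hp2⟩

/-- Rearranging the interior of a match preserves the number of descents if it preserves the
number of descents of the pattern. -/
lemma des_mul_blockPerm {τ ρ : Equiv.Perm (Fin j)} {σ : Equiv.Perm (Fin n)} {i : ℕ}
    (hm : IsMatchAt τ σ i) (hj : 0 < j)
    (h0 : ρ ⟨0, hj⟩ = ⟨0, hj⟩) (h1 : ρ ⟨j - 1, by omega⟩ = ⟨j - 1, by omega⟩)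
    (hdes : des (τ * ρ) = des τ) :
    des (σ * blockPerm ρ i hm.1) = des σ := by
  have h := hm.1
  unfold des
  -- Descents with both positions in the block are counted by the pattern. For any other descent,
  -- neither `p` nor `p + 1` is interior to the block, so both are fixed.
  rw [← Finset.card_filter_add_card_filter_not (s := desSet σ)
      (fun p : Fin n => i ≤ (p : ℕ) ∧ (p : ℕ) + 1 < i + j),
    ← Finset.card_filter_add_card_filter_not (s := desSet (σ * blockPerm ρ i hm.1))
      (fun p : Fin n => i ≤ (p : ℕ) ∧ (p : ℕ) + 1 < i + j),
    hm.card_desSet_block, (hm.mul_blockPerm ρ).card_desSet_block, hdes]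
  congr 2
  ext p
  simp only [Finset.mem_filter, mem_desSet]
  refine and_congr_left fun hp => exists_congr fun hpn => ?_
  rw [Equiv.Perm.mul_apply, Equiv.Perm.mul_apply,
    blockPerm_apply_of_notMem_interior hj h0 h1 h (p := p) (by omega),
    blockPerm_apply_of_notMem_interior hj h0 h1 h (p := ⟨p + 1, hpn⟩) (by simp only; omega)]

/-- The block is an interval mapped to itself, so a position outside it compares in the same way
with all of its positions. -/
lemma blockPerm_lt_blockPerm_iff (ρ : Equiv.Perm (Fin j)) {i : ℕ} (h : i + j ≤ n) {p r : Fin n}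
    (hpr : ¬ ((i ≤ (p : ℕ) ∧ (p : ℕ) < i + j) ∧ (i ≤ (r : ℕ) ∧ (r : ℕ) < i + j))) :
    blockPerm ρ i h p < blockPerm ρ i h r ↔ p < r := by
  have hp := blockPerm_mem_block ρ h p
  have hr := blockPerm_mem_block ρ h r
  rw [Fin.lt_def, Fin.lt_def]
  by_cases hpb : i ≤ (p : ℕ) ∧ (p : ℕ) < i + j
  · have hrb : ¬ (i ≤ (r : ℕ) ∧ (r : ℕ) < i + j) := fun hrb => hpr ⟨hpb, hrb⟩
    rw [blockPerm_apply_of_notMem ρ h hrb]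
    have := hp.mpr hpb
    omega
  · rw [blockPerm_apply_of_notMem ρ h hpb]
    by_cases hrb : i ≤ (r : ℕ) ∧ (r : ℕ) < i + j
    · have := hr.mpr hrb
      omega
    · rw [blockPerm_apply_of_notMem ρ h hrb]

/-- Rearranging a match preserves the number of inversions if it preserves the number of
inversions of the pattern. -/
lemma inv_mul_blockPerm {τ ρ : Equiv.Perm (Fin j)} {σ : Equiv.Perm (Fin n)} {i : ℕ}
    (hm : IsMatchAt τ σ i) (hinv : inv (τ * ρ) = inv τ) :
    inv (σ * blockPerm ρ i hm.1) = inv σ := by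
  have h := hm.1
  unfold inv
  rw [← Finset.card_filter_add_card_filter_not
      (s := Finset.univ.filter fun p : Fin n × Fin n => p.1 < p.2 ∧ σ p.2 < σ p.1)
      (fun p => (i ≤ (p.1 : ℕ) ∧ (p.1 : ℕ) < i + j) ∧ (i ≤ (p.2 : ℕ) ∧ (p.2 : ℕ) < i + j)),
    ← Finset.card_filter_add_card_filter_not
      (s := Finset.univ.filter fun p : Fin n × Fin n =>
        p.1 < p.2 ∧ (σ * blockPerm ρ i hm.1) p.2 < (σ * blockPerm ρ i hm.1) p.1)
      (fun p => (i ≤ (p.1 : ℕ) ∧ (p.1 : ℕ) < i + j) ∧ (i ≤ (p.2 : ℕ) ∧ (p.2 : ℕ) < i + j)),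
    hm.card_inv_block, (hm.mul_blockPerm ρ).card_inv_block, hinv]
  congr 1
  -- Inversions not contained in the block are carried along by the rearrangement; unlike for
  -- descents, the ends need not be fixed.
  refine Finset.card_bij (fun p _ => (blockPerm ρ i h p.1, blockPerm ρ i h p.2)) ?_ ?_ ?_
  · rintro ⟨p, r⟩ hp
    simp only [Finset.mem_filter, Finset.mem_univ, true_and] at hp ⊢
    simp only [Equiv.Perm.mul_apply] at hp ⊢
    rw [blockPerm_mem_block, blockPerm_mem_block, blockPerm_lt_blockPerm_iff ρ h hp.2]
    exact hp
  · rintro ⟨a, b⟩ _ ⟨c, d⟩ _ hab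
    simpa using hab
  · rintro ⟨p, r⟩ hp
    obtain ⟨p, rfl⟩ := (blockPerm ρ i h).surjective p
    obtain ⟨r, rfl⟩ := (blockPerm ρ i h).surjective r
    refine ⟨(p, r), ?_, rfl⟩
    simp only [Finset.mem_filter, Finset.mem_univ, true_and] at hp ⊢
    simp only [Equiv.Perm.mul_apply] at hp ⊢
    rw [blockPerm_mem_block, blockPerm_mem_block] at hp
    rwa [blockPerm_lt_blockPerm_iff ρ h hp.2] at hp

end Block

/-! ### Inclusion-exclusion and the exchange of marked matches. -/

section InclusionExclusion

variable {j n : ℕ} {R : Type*} [CommRing R]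

/-- Inclusion-exclusion over sets of marked matches. -/
lemma sum_NM_eq_sum_powerset (τ : Equiv.Perm (Fin j))
    (w : Equiv.Perm (Fin n) → R) :
    ∑ σ ∈ NM n τ, w σ = ∑ S ∈ (Finset.range n).powerset, (-1) ^ S.card *
      ∑ σ ∈ Finset.univ.filter (fun σ : Equiv.Perm (Fin n) => ∀ i ∈ S, IsMatchAt τ σ i), w σ := by
  have hz : ∀ σ : Equiv.Perm (Fin n), (if mch τ σ = 0 then w σ else 0) =
      ∑ S ∈ (Finset.range n).powerset,
        if ∀ i ∈ S, IsMatchAt τ σ i then (-1) ^ S.card * w σ else 0 := by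
    intro σ
    have hset : (Finset.range n).powerset.filter (fun S => ∀ i ∈ S, IsMatchAt τ σ i) =
        ((Finset.range n).filter fun i => IsMatchAt τ σ i).powerset := by
      ext S
      simp only [Finset.mem_filter, Finset.mem_powerset, Finset.subset_iff]
      exact ⟨fun h i hi => ⟨h.1 hi, h.2 i hi⟩, fun h => ⟨fun i hi => (h hi).1,
        fun i hi => (h hi).2⟩⟩
    rw [← Finset.sum_filter, hset, ← Finset.sum_mul]
    have := congrArg (Int.cast : ℤ → R) (Finset.sum_powerset_neg_one_pow_card
      (x := (Finset.range n).filter fun i => IsMatchAt τ σ i))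
    push_cast at this
    rw [this]
    simp only [mch, Finset.card_eq_zero]
    split_ifs <;> simp
  unfold NM
  rw [Finset.sum_filter, Finset.sum_congr rfl fun σ _ => hz σ, Finset.sum_comm]
  refine Finset.sum_congr rfl fun S _ => ?_
  rw [← Finset.sum_filter, Finset.mul_sum]

/-- If the weight `w` is unchanged when a match of `α` is rearranged into a match of `β`, then the
matches of `α` in a set `A` may be replaced by matches of `β`. -/
lemma sum_marked_eq {α β : Equiv.Perm (Fin j)} (hj : 0 < j)
    (hfirst : α ⟨0, hj⟩ = β ⟨0, hj⟩) (hlast : α ⟨j - 1, by omega⟩ = β ⟨j - 1, by omega⟩)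
    (w : Equiv.Perm (Fin n) → R)
    (hw : ∀ (σ : Equiv.Perm (Fin n)) (i : ℕ) (hm : IsMatchAt α σ i),
      w (σ * blockPerm (α⁻¹ * β) i hm.1) = w σ)
    (A : Finset ℕ) : ∀ B : Finset ℕ, Disjoint A B →
      (∀ i ∈ A ∪ B, ∀ i' ∈ A ∪ B, i < i' → i + j ≤ i' + 1) →
      ∑ σ ∈ Finset.univ.filter (fun σ : Equiv.Perm (Fin n) =>
          (∀ i ∈ A, IsMatchAt α σ i) ∧ ∀ i ∈ B, IsMatchAt β σ i), w σ =
        ∑ σ ∈ Finset.univ.filter (fun σ : Equiv.Perm (Fin n) =>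
          ∀ i ∈ A ∪ B, IsMatchAt β σ i), w σ := by
  -- `B` stays general because each step moves one mark `a` from the `α`-side to the `β`-side,
  -- leaving the union unchanged.
  induction A using Finset.induction_on with
  | empty => intro B _ _; simp
  | insert a A ha ih =>
    intro B hdisj hsp
    have haB : a ∉ B := Finset.disjoint_left.mp hdisj (Finset.mem_insert_self _ _)
    have hAB : Disjoint A B := hdisj.mono_left (Finset.subset_insert _ _)
    have hunion : insert a A ∪ B = A ∪ insert a B := by
      ext x
      simp only [Finset.mem_union, Finset.mem_insert]
      tauto
    rw [hunion] at hsp ⊢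
    rw [← ih (insert a B) (by rw [Finset.disjoint_insert_right]; exact ⟨ha, hAB⟩) hsp]
    have hfar : ∀ i, i ∈ A ∨ i ∈ B → a + j ≤ i + 1 ∨ i + j ≤ a + 1 := by
      intro i hi
      have hmem : i ∈ A ∪ insert a B := by
        simp only [Finset.mem_union, Finset.mem_insert]
        tauto
      have hmem' : a ∈ A ∪ insert a B := by simp
      have hne : i ≠ a := by
        rintro rfl
        tauto
      rcases lt_or_gt_of_ne hne with h | h
      · exact Or.inr (hsp i hmem a hmem' h)
      · exact Or.inl (hsp a hmem' i hmem h)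
    have hρ0 : (α⁻¹ * β) ⟨0, hj⟩ = ⟨0, hj⟩ := by
      rw [Equiv.Perm.mul_apply, ← hfirst]
      simp
    have hρ1 : (α⁻¹ * β) ⟨j - 1, by omega⟩ = ⟨j - 1, by omega⟩ := by
      rw [Equiv.Perm.mul_apply, ← hlast]
      simp
    have hρ0' : (α⁻¹ * β)⁻¹ ⟨0, hj⟩ = ⟨0, hj⟩ := by rw [Equiv.Perm.inv_eq_iff_eq, hρ0]
    have hρ1' : (α⁻¹ * β)⁻¹ ⟨j - 1, by omega⟩ = ⟨j - 1, by omega⟩ := by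
      rw [Equiv.Perm.inv_eq_iff_eq, hρ1]
    -- If the block at `a` does not fit into `n` positions, no match starts there and both sums are
    -- empty.
    by_cases han : a + j ≤ n
    · refine Finset.sum_bij (fun σ _ => σ * blockPerm (α⁻¹ * β) a han) ?_ ?_ ?_ ?_
      · intro σ hσ
        simp only [Finset.mem_filter, Finset.mem_univ, true_and, Finset.mem_insert,
          forall_eq_or_imp] at hσ ⊢
        obtain ⟨⟨h1, h2⟩, h3⟩ := hσ
        refine ⟨fun i hi => (h2 i hi).mul_blockPerm_of_disjoint hj hρ0 hρ1 han (hfar i (.inl hi)),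
          ?_, fun i hi => (h3 i hi).mul_blockPerm_of_disjoint hj hρ0 hρ1 han (hfar i (.inr hi))⟩
        simpa using h1.mul_blockPerm (α⁻¹ * β)
      · intro σ _ σ' _ h
        exact mul_right_cancel h
      · intro σ hσ
        simp only [Finset.mem_filter, Finset.mem_univ, true_and, Finset.mem_insert,
          forall_eq_or_imp] at hσ
        obtain ⟨h2, h1, h3⟩ := hσ
        refine ⟨σ * blockPerm (α⁻¹ * β)⁻¹ a han, ?_, ?_⟩
        · simp only [Finset.mem_filter, Finset.mem_univ, true_and, Finset.mem_insert,
            forall_eq_or_imp]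
          refine ⟨⟨?_, fun i hi =>
            (h2 i hi).mul_blockPerm_of_disjoint hj hρ0' hρ1' han (hfar i (.inl hi))⟩,
            fun i hi => (h3 i hi).mul_blockPerm_of_disjoint hj hρ0' hρ1' han (hfar i (.inr hi))⟩
          have := h1.mul_blockPerm (α⁻¹ * β)⁻¹
          rwa [mul_inv_rev, inv_inv, mul_inv_cancel_left] at this
        · have := blockPerm_mul_blockPerm_inv (α⁻¹ * β)⁻¹ han
          rw [inv_inv] at this
          rw [mul_assoc, this, mul_one]
      · intro σ hσ
        simp only [Finset.mem_filter, Finset.mem_univ, true_and, Finset.mem_insert,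
          forall_eq_or_imp] at hσ
        exact (hw σ a hσ.1.1).symm
    · rw [Finset.filter_eq_empty_iff.mpr, Finset.filter_eq_empty_iff.mpr]
      · rintro σ - ⟨-, h⟩
        exact han (h a (Finset.mem_insert_self _ _)).1
      · rintro σ - ⟨h, -⟩
        exact han (h a (Finset.mem_insert_self _ _)).1

/-- Two minimal overlapping permutations with the same first and last letters give the same
weighted count of permutations without matches, for every weight that is unchanged when a match of
the first is rearranged into a match of the second. -/
theorem sum_NM_eq {α β : Equiv.Perm (Fin j)} (hα : MinimalOverlapping α)
    (hβ : MinimalOverlapping β) (hj : 0 < j)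
    (hfirst : α ⟨0, hj⟩ = β ⟨0, hj⟩) (hlast : α ⟨j - 1, by omega⟩ = β ⟨j - 1, by omega⟩)
    (w : Equiv.Perm (Fin n) → R)
    (hw : ∀ (σ : Equiv.Perm (Fin n)) (i : ℕ) (hm : IsMatchAt α σ i),
      w (σ * blockPerm (α⁻¹ * β) i hm.1) = w σ) :
    ∑ σ ∈ NM n α, w σ = ∑ σ ∈ NM n β, w σ := by
  rw [sum_NM_eq_sum_powerset, sum_NM_eq_sum_powerset]
  refine Finset.sum_congr rfl fun S _ => ?_
  congr 1
  -- Well-spaced marks are exchanged; for all other `S` no permutation matches at every mark, for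
  -- either pattern.
  by_cases hS : ∀ i ∈ S, ∀ i' ∈ S, i < i' → i + j ≤ i' + 1
  · simpa using sum_marked_eq hj hfirst hlast w hw S ∅ (by simp) (by simpa using hS)
  · have hempty : ∀ {τ : Equiv.Perm (Fin j)}, MinimalOverlapping τ →
        Finset.univ.filter (fun σ : Equiv.Perm (Fin n) => ∀ i ∈ S, IsMatchAt τ σ i) = ∅ := by
      intro τ hτ
      rw [Finset.filter_eq_empty_iff]
      exact fun σ _ h => hS fun i hi i' hi' => hτ.add_le_of_lt (h i hi) (h i' hi')
    rw [hempty hα, hempty hβ]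

end InclusionExclusion

end CWilf


theorem theorem1p6 {j : ℕ} (hj : 3 ≤ j) (α β : Equiv.Perm (Fin j))
    (hα : CWilf.MinimalOverlapping α) (hβ : CWilf.MinimalOverlapping β)
    (hα1 : α ⟨0, by omega⟩ = ⟨0, by omega⟩) (hβ1 : β ⟨0, by omega⟩ = ⟨0, by omega⟩)
    (hlast : α ⟨j - 1, by omega⟩ = β ⟨j - 1, by omega⟩)
    (hdes : CWilf.des α = CWilf.des β) :
    (CWilf.desEGF α = CWilf.desEGF β ∧ CWilf.StatCWilfEquiv ![CWilf.desStat] α β) ∧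
    (CWilf.inv α = CWilf.inv β →
      CWilf.desInvQEGF α = CWilf.desInvQEGF β ∧
      CWilf.StatCWilfEquiv ![CWilf.desStat, CWilf.invStat] α β) := by
  have hj0 : 0 < j := by omega
  have hfirst : α ⟨0, hj0⟩ = β ⟨0, hj0⟩ := hα1.trans hβ1.symm
  have hρ0 : (α⁻¹ * β) ⟨0, hj0⟩ = ⟨0, hj0⟩ := by
    rw [Equiv.Perm.mul_apply, ← hfirst]
    simp
  have hρ1 : (α⁻¹ * β) ⟨j - 1, by omega⟩ = ⟨j - 1, by omega⟩ := by
    rw [Equiv.Perm.mul_apply, ← hlast]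
    simp
  have hd : ∀ {n : ℕ} (σ : Equiv.Perm (Fin n)) (i : ℕ) (hm : CWilf.IsMatchAt α σ i),
      CWilf.des (σ * CWilf.blockPerm (α⁻¹ * β) i hm.1) = CWilf.des σ := fun σ i hm =>
    CWilf.des_mul_blockPerm hm hj0 hρ0 hρ1 (by rw [mul_inv_cancel_left, hdes])
  refine ⟨⟨?_, ?_⟩, fun hinv => ?_⟩
  · ext1 n
    simp only [CWilf.desEGF, PowerSeries.coeff_mk]
    rw [CWilf.sum_NM_eq hα hβ hj0 hfirst hlast _ fun σ i hm => by simp only [hd σ i hm]]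
  · intro n _
    refine CWilf.sum_NM_eq hα hβ hj0 hfirst hlast _ fun σ i hm => ?_
    simp [CWilf.desStat, hd σ i hm]
  · have hi : ∀ {n : ℕ} (σ : Equiv.Perm (Fin n)) (i : ℕ) (hm : CWilf.IsMatchAt α σ i),
        CWilf.inv (σ * CWilf.blockPerm (α⁻¹ * β) i hm.1) = CWilf.inv σ := fun σ i hm =>
      CWilf.inv_mul_blockPerm hm (by rw [mul_inv_cancel_left, hinv])
    constructor
    · ext1 n
      simp only [CWilf.desInvQEGF, PowerSeries.coeff_mk]
      rw [CWilf.sum_NM_eq hα hβ hj0 hfirst hlast _ fun σ i hm => by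
        simp only [hd σ i hm, hi σ i hm]]
    · intro n _
      refine CWilf.sum_NM_eq hα hβ hj0 hfirst hlast _ fun σ i hm => ?_
      simp [CWilf.desStat, CWilf.invStat, Fin.prod_univ_two, hd σ i hm, hi σ i hm]
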